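/- Let $n\ge 1$ and $\mathbf b=(b_1,\dots,b_n)\in\mathbb Z_{>0}^n$. A $\mathbf b$-parking function is a list $(\beta_1,\dots,\beta_n)$ of positive integers whose nondecreasing rearrangement $\beta'_1\le\dots\le\beta'_n$ satisfies $\beta'_i\le b_1+\dots+b_i$ for all $i$; the classical parking functions are those for $\mathbf b=(1,\dots,1)$. Let $\mathfrak X_n(\mathbf b)\subset\mathbb R^n$ be the convex hull of all $\mathbf b$-parking functions, and let $\mathsf{PF}_n=\mathfrak X_n(1,\dots,1)$ be the classical parking-function polytope. A stellohedron $\mathsf{St}_n$ is a Minkowski sum $\sum_{I\in\mathcal B} y_I\,\Delta_I\subset\mathbb R^{n+1}$ with arbitrary real coefficients $y_I>0$ for $I\in\mathcal B$, where $\Delta_I=\operatorname{conv}\{\mathbf e_i : i\in I\}$ and $\mathcal B=\{\{1\},\dots,\{n\}\}\cup\{S\cup\{n+1\} : S\subseteq\{1,\dots,n\}\}$. Two polytopes are combinatorially equivalent if their face lattices are isomorphic as partially ordered sets. Then $\mathfrak X_n(\mathbf b)$ is combinatorially equivalent to $\mathsf{PF}_n$ if $b_1=1$, and it is combinatorially equivalent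 to every stellohedron $\mathsf{St}_n$ (for every choice of the positive coefficients $y_I$) if $b_1\ge 2$. -/

import Mathlib

/-- Two convex polytopes `P` and `Q`, possibly in different ambient spaces, are combinatorially
equivalent if their face lattices are isomorphic. The faces of a polytope are its exposed subsets:
the empty face and the sets of maximizers over the polytope of a linear functional (the zero
functional gives the polytope itself). They are ordered by inclusion. -/
def CombinatoriallyEquivalent {V W : Type*}
    [AddCommGroup V] [Module ℝ V] [TopologicalSpace V]
    [AddCommGroup W] [Module ℝ W] [TopologicalSpace W]
    (P : Set V) (Q : Set W) : Prop :=
  Nonempty ({F : Set V // IsExposed ℝ P F} ≃o {G : Set W // IsExposed ℝ Q G})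

/-- `β` is a `b`-parking function: a list of positive integers whose nondecreasing rearrangement
`β ∘ σ` has `i`-th entry at most `b₁ + ⋯ + bᵢ`. -/
def IsBParkingFunction {n : ℕ} (b β : Fin n → ℕ) : Prop :=
  (∀ i, 0 < β i) ∧
    ∃ σ : Equiv.Perm (Fin n), Monotone (β ∘ σ) ∧ ∀ i, β (σ i) ≤ ∑ j ∈ Finset.Iic i, b j

/-- `α` is a classical parking function: a list of positive integers whose nondecreasing
rearrangement `α ∘ σ` has `i`-th entry at most `i` (the index `i : Fin n` counts from zero). -/
def IsParkingFunction {n : ℕ} (α : Fin n → ℕ) : Prop :=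
  (∀ i, 0 < α i) ∧
    ∃ σ : Equiv.Perm (Fin n), Monotone (α ∘ σ) ∧ ∀ i : Fin n, α (σ i) ≤ (i : ℕ) + 1

/-- The `b`-parking-function polytope `𝔛ₙ(b)` in `ℝⁿ`. -/
def bParkingPolytope {n : ℕ} (b : Fin n → ℕ) : Set (Fin n → ℝ) :=
  convexHull ℝ {x | ∃ β : Fin n → ℕ, IsBParkingFunction b β ∧ x = fun i => (β i : ℝ)}

/-- The classical parking-function polytope `PFₙ` in `ℝⁿ`. -/
def parkingPolytope (n : ℕ) : Set (Fin n → ℝ) :=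
  convexHull ℝ {x | ∃ α : Fin n → ℕ, IsParkingFunction α ∧ x = fun i => (α i : ℝ)}

/-- A building set on the finite set `E`. -/
structure IsBuildingSet {E : Type*} [DecidableEq E] (B : Finset (Finset E)) : Prop where
  nonempty : ∀ I ∈ B, I.Nonempty
  union_mem : ∀ I ∈ B, ∀ J ∈ B, (I ∩ J).Nonempty → I ∪ J ∈ B
  singleton_mem : ∀ i : E, {i} ∈ B

/-- The simplex `Δ_I`, the convex hull of the standard basis vectors `eᵢ`, `i ∈ I`, of `ℝ^E`. -/
def coordSimplex {E : Type*} [DecidableEq E] (I : Finset E) : Set (E → ℝ) :=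
  convexHull ℝ {x | ∃ i ∈ I, x = Pi.single i 1}

section

open scoped Pointwise

/-- The Minkowski sum of the dilated simplices `y_I Δ_I`, `I ∈ B`. For a building set `B` and
coefficients `y_I > 0` for all `I ∈ B`, this is a nestohedron of `B`. -/
noncomputable def nestohedron {E : Type*} [DecidableEq E]
    (B : Finset (Finset E)) (y : Finset E → ℝ) : Set (E → ℝ) :=
  ∑ I ∈ B, y I • coordSimplex I

end

/-- The collection `{{1}, …, {n}} ∪ {S ∪ {n+1} : S ⊆ [n]}` of subsets of `[n+1]`. Here `[n+1]` is
`Fin (n + 1)`, its last element plays the role of `n+1`, and the `i.castSucc` form `[n]`. -/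
def stellohedronBuildingSet (n : ℕ) : Finset (Finset (Fin (n + 1))) :=
  (Finset.univ : Finset (Fin n)).image (fun i => {i.castSucc}) ∪
    (Finset.univ : Finset (Finset (Fin n))).image
      (fun S => S.image Fin.castSucc ∪ {Fin.last n})

theorem mem_stellohedronBuildingSet {n : ℕ} {I : Finset (Fin (n + 1))} :
    I ∈ stellohedronBuildingSet n ↔ (∃ i : Fin n, I = {i.castSucc}) ∨ Fin.last n ∈ I := by
  simp only [stellohedronBuildingSet, Finset.mem_union, Finset.mem_image, Finset.mem_univ,
    true_and]
  constructor
  · rintro (⟨i, rfl⟩ | ⟨S, rfl⟩)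
    · exact Or.inl ⟨i, rfl⟩
    · exact Or.inr (by simp)
  · rintro (⟨i, rfl⟩ | h)
    · exact Or.inl ⟨i, rfl⟩
    · refine Or.inr ⟨Finset.univ.filter (fun i => i.castSucc ∈ I), ?_⟩
      ext j
      refine Fin.lastCases ?_ (fun i => ?_) j
      · simp [h]
      · simp [Fin.castSucc_ne_last]

theorem isBuildingSet_stellohedronBuildingSet (n : ℕ) :
    IsBuildingSet (stellohedronBuildingSet n) where
  nonempty I hI := by
    rcases mem_stellohedronBuildingSet.1 hI with ⟨i, rfl⟩ | h
    · exact Finset.singleton_nonempty _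
    · exact ⟨_, h⟩
  union_mem I hI J hJ h := by
    rw [mem_stellohedronBuildingSet] at *
    rcases hI with ⟨i, rfl⟩ | hI
    · rcases hJ with ⟨j, rfl⟩ | hJ
      · obtain ⟨k, hk⟩ := h
        simp only [Finset.mem_inter, Finset.mem_singleton] at hk
        refine Or.inl ⟨i, ?_⟩
        rw [← hk.2, hk.1, Finset.union_self]
      · exact Or.inr (Finset.mem_union_right _ hJ)
    · exact Or.inr (Finset.mem_union_left _ hI)
  singleton_mem i := by
    rw [mem_stellohedronBuildingSet]
    refine Fin.lastCases (Or.inr (by simp)) (fun i => Or.inl ⟨i, rfl⟩) i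

/-- `P` is a stellohedron `Stₙ` in `ℝ^(n+1)`: a nestohedron of the building set
`{{1}, …, {n}} ∪ {S ∪ {n+1} : S ⊆ [n]}`, with some positive coefficients. -/
def IsStellohedron (n : ℕ) (P : Set (Fin (n + 1) → ℝ)) : Prop :=
  ∃ y : Finset (Fin (n + 1)) → ℝ,
    (∀ I ∈ stellohedronBuildingSet n, 0 < y I) ∧ P = nestohedron (stellohedronBuildingSet n) y

/-- The standard stellohedron, with all coefficients equal to one. -/
theorem exists_isStellohedron (n : ℕ) : ∃ P, IsStellohedron n P :=
  ⟨_, fun _ => 1, fun _ _ => one_pos, rfl⟩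

/-! Both polytopes are hulls of points indexed, with repetitions, by the permutations `τ` of `Fin (n
+ 1)`. A face is recovered from the indices of the points it contains, so the face lattice depends
only on which `τ` maximize which functionals (`nonempty_faces_orderIso`).

A functional is encoded by weights `C` on `Fin (n + 1)`; on the parking side they are normalized so
that the last weight is zero. In both cases `τ` is a maximizer exactly when `RankCompatible H C τ`.
For the stellohedron, `τ` chooses its highest-ranked element in each member of the building set. For
the parking polytope the rearrangement inequality applies: positive weights want large initial sums,
negative ones want the value one (`rankCompatible_of_forall_le`, `sum_mul_le_of_rankCompatible`).

The vector `b` enters only through `H m`, that is `1 < initialSum b m`: a rank with smaller sum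
receives the value one in any case and imposes no condition. If the first entry is one, `H` means `1
< m`, as for the all-ones vector. If it is at least two, `H` holds at every positive rank, and rank
zero is vacuous; this is the stellohedron's relation. -/

section Faces

/-! ### Faces of a polytope from maximizers among finitely many points. -/

variable {V : Type*} [NormedAddCommGroup V] [NormedSpace ℝ V] {ι : Type*}

/-- A convex set containing the points `v i`, over which every linear functional is maximized at
one of the `v i`, is their convex hull. -/
theorem eq_convexHull_range_of_forall_exists_max [Finite ι] {P : Set V} (hP : Convex ℝ P)
    (v : ι → V)
    (hv : ∀ i, v i ∈ P) (hmax : ∀ l : V →L[ℝ] ℝ, ∃ i, ∀ x ∈ P, l x ≤ l (v i)) :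
    P = convexHull ℝ (Set.range v) := by
  refine Set.Subset.antisymm (fun x hx => ?_)
    (convexHull_min (𝕜 := ℝ) (Set.range_subset_iff.2 hv) hP)
  by_contra hxv
  obtain ⟨l, u, hl, hu⟩ := geometric_hahn_banach_closed_point (convex_convexHull ℝ (Set.range v))
    ((Set.finite_range v).isClosed_convexHull ℝ) hxv
  obtain ⟨i, hi⟩ := hmax l
  linarith [hi x hx, hl _ (subset_convexHull ℝ _ (Set.mem_range_self i))]

/-- The face of the convex hull of a finite family selected by a linear functional is the convex
hull of the members of the family that it contains. -/
theorem face_eq_convexHull_image (v : ι → V) (l : V →L[ℝ] ℝ) (F : Set V)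
    (hF : F = {x ∈ convexHull ℝ (Set.range v) | ∀ y ∈ convexHull ℝ (Set.range v), l y ≤ l x}) :
    F = convexHull ℝ (v '' {i | v i ∈ F}) := by
  have hmem : ∀ i, v i ∈ convexHull ℝ (Set.range v) := fun i =>
    subset_convexHull ℝ _ (Set.mem_range_self i)
  have hexp : IsExposed ℝ (convexHull ℝ (Set.range v)) F := fun _ => ⟨l, hF⟩
  refine Set.Subset.antisymm (fun x hx => ?_)
    (convexHull_min (by rintro _ ⟨i, hi, rfl⟩; exact hi)
      (hexp.convex (convex_convexHull ℝ _)))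
  have hx' := hx
  rw [hF] at hx'
  obtain ⟨hxP, hxmax⟩ := hx'
  obtain ⟨κ, _, w, z, hw, hw1, hz, rfl⟩ := mem_convexHull_iff_exists_fintype.1 hxP
  choose g hg using hz
  have hle : ∀ k, l (z k) ≤ l (∑ k, w k • z k) := fun k => hg k ▸ hxmax _ (hmem _)
  -- The weighted average of the nonnegative deficits is zero, so each point of nonzero weight is
  -- itself a maximizer.
  have hzero : ∑ k, w k * (l (∑ k, w k • z k) - l (z k)) = 0 := by
    simp only [mul_sub, Finset.sum_sub_distrib, ← Finset.sum_mul, hw1]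
    simp
  have hterm := (Finset.sum_eq_zero_iff_of_nonneg fun k _ =>
    mul_nonneg (hw k) (sub_nonneg.2 (hle k))).1 hzero
  have hmemF : ∀ k, w k ≠ 0 → z k ∈ v '' {i | v i ∈ F} := by
    intro k hk
    refine ⟨g k, ?_, hg k⟩
    have hlk : l (∑ k, w k • z k) - l (z k) = 0 :=
      (mul_eq_zero.1 (hterm k (Finset.mem_univ k))).resolve_left hk
    change v (g k) ∈ F
    rw [hF]
    refine ⟨hmem _, fun y hy => (hxmax y hy).trans ?_⟩
    rw [hg k]
    linarith
  rw [← Finset.sum_filter_of_ne (p := fun k => w k ≠ 0)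
    fun k _ h => (smul_ne_zero_iff.1 h).1]
  refine (convex_convexHull ℝ _).sum_mem (fun k _ => hw k) ?_
    fun k hk => subset_convexHull ℝ _ (hmemF k (Finset.mem_filter.1 hk).2)
  rw [Finset.sum_filter_ne_zero, hw1]

/-- If the vertex sets of the nonempty faces of a polytope are described by the relation `R`, its
face lattice is determined by `R`. -/
theorem nonempty_faces_orderIso [Finite ι] {γ : Type*} {P : Set V} (hP : Convex ℝ P) (v : ι → V)
    (hv : ∀ i, v i ∈ P) (R : γ → ι → Prop) (hR : ∀ c, ∃ i, R c i)
    (h₁ : ∀ l : V →L[ℝ] ℝ, ∃ c, ∀ i, (∀ x ∈ P, l x ≤ l (v i)) ↔ R c i)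
    (h₂ : ∀ c, ∃ l : V →L[ℝ] ℝ, ∀ i, (∀ x ∈ P, l x ≤ l (v i)) ↔ R c i) :
    Nonempty ({F : Set V // IsExposed ℝ P F} ≃o
      {S : Set ι // S = ∅ ∨ ∃ c, S = {i | R c i}}) := by
  have hPv : P = convexHull ℝ (Set.range v) :=
    eq_convexHull_range_of_forall_exists_max hP v hv fun l => by
      obtain ⟨c, hc⟩ := h₁ l
      obtain ⟨i, hi⟩ := hR c
      exact ⟨i, (hc i).2 hi⟩
  have hface : ∀ F : Set V, IsExposed ℝ P F → F = convexHull ℝ (v '' {i | v i ∈ F}) := by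
    intro F hF
    rcases F.eq_empty_or_nonempty with rfl | hne
    · simp
    · obtain ⟨l, hl⟩ := hF hne
      exact face_eq_convexHull_image v l F (hPv ▸ hl)
  have htrace : ∀ (l : V →L[ℝ] ℝ) (c : γ), (∀ i, (∀ x ∈ P, l x ≤ l (v i)) ↔ R c i) →
      {i | v i ∈ {x ∈ P | ∀ y ∈ P, l y ≤ l x}} = {i | R c i} := by
    intro l c hc
    ext i
    simp [hv i, hc i]
  -- Each face is the hull of its indexed points, so recording their indices reflects inclusion as
  -- well as preserving it.
  let f : {F : Set V // IsExposed ℝ P F} ↪o {S : Set ι // S = ∅ ∨ ∃ c, S = {i | R c i}} :=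
    OrderEmbedding.ofMapLEIff (fun F => ⟨{i | v i ∈ F.1}, by
      rcases F.1.eq_empty_or_nonempty with h | hne
      · left; simp [h]
      · obtain ⟨l, hl⟩ := F.2 hne
        obtain ⟨c, hc⟩ := h₁ l
        right
        refine ⟨c, ?_⟩
        rw [hl]
        exact htrace l c hc⟩) (fun F G => by
      refine ⟨fun h => ?_, fun h i hi => h hi⟩
      change F.1 ⊆ G.1
      rw [hface F.1 F.2, hface G.1 G.2]
      exact convexHull_mono (Set.image_mono h))
  refine ⟨RelIso.ofSurjective f ?_⟩
  rintro ⟨S, rfl | ⟨c, rfl⟩⟩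
  · exact ⟨⟨∅, fun h => absurd h Set.not_nonempty_empty⟩, Subtype.ext (by ext; simp [f])⟩
  · obtain ⟨l, hl⟩ := h₂ c
    exact ⟨⟨{x ∈ P | ∀ y ∈ P, l y ≤ l x}, fun _ => ⟨l, rfl⟩⟩, Subtype.ext (htrace l c hl)⟩

end Faces

/-! ### The common combinatorial relation between weights and permutations. -/

section Compat

/-- The permutation `τ` of `Fin (n + 1)` sorts the values of `C` in the part where it matters:
above the rank of the last element, and where `H` holds. -/
def RankCompatible {n : ℕ} (H : ℕ → Prop) (C : Fin (n + 1) → ℝ)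
    (τ : Equiv.Perm (Fin (n + 1))) : Prop :=
  ∀ i j, H (τ i) → τ (Fin.last n) ≤ τ i → τ j < τ i → C j ≤ C i

theorem exists_rankCompatible {n : ℕ} (H : ℕ → Prop) (C : Fin (n + 1) → ℝ) :
    ∃ τ, RankCompatible H C τ := by
  refine ⟨(Tuple.sort C).symm, fun i j _ _ hij => ?_⟩
  simpa using Tuple.monotone_sort C hij.le

theorem rankCompatible_sub_const {n : ℕ} {H : ℕ → Prop} {C : Fin (n + 1) → ℝ} (a : ℝ)
    {τ : Equiv.Perm (Fin (n + 1))} :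
    RankCompatible H (fun i => C i - a) τ ↔ RankCompatible H C τ := by
  simp [RankCompatible]

/-- The relation of compatibility above all ranks but the lowest needs no condition on ranks. -/
theorem rankCompatible_pos_iff {n : ℕ} {H : ℕ → Prop} (hH : ∀ m, 0 < m → m ≤ n → H m)
    {C : Fin (n + 1) → ℝ} {τ : Equiv.Perm (Fin (n + 1))} :
    RankCompatible H C τ ↔ ∀ i j, τ (Fin.last n) ≤ τ i → τ j ≤ τ i → C j ≤ C i := by
  constructor
  · intro h i j hi hj
    rcases hj.eq_or_lt with hj | hj
    · rw [τ.injective hj]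
    · exact h i j (hH _ ((Nat.zero_le _).trans_lt (Fin.lt_def.1 hj)) (by omega)) hi hj
  · exact fun h i j _ hi hj => h i j hi hj.le

end Compat

/-! ### Maximizers on nestohedra and the faces of the stellohedron. -/

section Nestohedron

open scoped Pointwise

theorem apply_le_of_mem_coordSimplex {E : Type*} [DecidableEq E] {I : Finset E}
    (l : (E → ℝ) →ₗ[ℝ] ℝ)
    {a : ℝ} (h : ∀ i ∈ I, l (Pi.single i 1) ≤ a) {x : E → ℝ} (hx : x ∈ coordSimplex I) :
    l x ≤ a := by
  have : coordSimplex I ⊆ {x | l x ≤ a} :=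
    convexHull_min (by rintro _ ⟨i, hi, rfl⟩; exact h i hi)
      (convex_halfSpace_le l.isLinear a)
  exact this hx

theorem sum_smul_single_mem_nestohedron {E : Type*} [DecidableEq E] {B : Finset (Finset E)}
    {y : Finset E → ℝ} {g : Finset E → E} (hg : ∀ I ∈ B, g I ∈ I) :
    ∑ I ∈ B, y I • (Pi.single (g I) 1 : E → ℝ) ∈ nestohedron B y :=
  Set.finsetSum_mem_finsetSum _ _ _ fun I hI =>
    Set.smul_mem_smul_set (subset_convexHull ℝ _ ⟨g I, hg I hI, rfl⟩)

theorem convex_nestohedron {E : Type*} [DecidableEq E] (B : Finset (Finset E))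
    (y : Finset E → ℝ) : Convex ℝ (nestohedron B y) :=
  convex_sum _ fun _ _ => (convex_convexHull ℝ _).smul _

/-- A choice of one element from each member of `B` gives a maximizer of `l` on the nestohedron if
and only if it chooses maximizers of `l`. -/
theorem forall_mem_nestohedron_le_iff {E : Type*} [DecidableEq E] {B : Finset (Finset E)}
    {y : Finset E → ℝ} (hy : ∀ I ∈ B, 0 < y I) {g : Finset E → E} (hg : ∀ I ∈ B, g I ∈ I)
    (l : (E → ℝ) →ₗ[ℝ] ℝ) :
    (∀ x ∈ nestohedron B y, l x ≤ l (∑ I ∈ B, y I • Pi.single (g I) 1)) ↔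
      ∀ I ∈ B, ∀ j ∈ I, l (Pi.single j 1) ≤ l (Pi.single (g I) 1) := by
  constructor
  · intro h I hI j hj
    by_contra! hlt
    -- Changing the choice at the single member `I` would strictly increase `l`.
    have hx := h _ (sum_smul_single_mem_nestohedron (g := Function.update g I j) fun J hJ => by
      rcases eq_or_ne J I with rfl | hne
      · simpa using hj
      · simpa [hne] using hg J hJ)
    simp only [map_sum, map_smul, smul_eq_mul] at hx
    refine hx.not_gt (Finset.sum_lt_sum (fun J hJ => ?_) ⟨I, hI, ?_⟩)
    · rcases eq_or_ne J I with rfl | hne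
      · simpa using mul_le_mul_of_nonneg_left hlt.le (hy J hJ).le
      · simp [hne]
    · simpa using mul_lt_mul_of_pos_left hlt (hy I hI)
  · intro h x hx
    obtain ⟨z, hz, rfl⟩ := (Set.mem_finsetSum _ _ _).1 hx
    simp only [map_sum, map_smul, smul_eq_mul]
    refine Finset.sum_le_sum fun I hI => ?_
    obtain ⟨u, hu, hzu⟩ := hz hI
    rw [← hzu]
    simpa using mul_le_mul_of_nonneg_left (apply_le_of_mem_coordSimplex l (h I hI) hu) (hy I hI).le

/-- Sets containing the last element realize every comparison above its rank, and singletons impose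
none. The flexible `H` allows matching with the parking polytope. -/
theorem stellohedron_faces {n : ℕ} {H : ℕ → Prop} (hH : ∀ m, 0 < m → m ≤ n → H m)
    {P : Set (Fin (n + 1) → ℝ)} (hP : IsStellohedron n P) :
    Nonempty ({F : Set (Fin (n + 1) → ℝ) // IsExposed ℝ P F} ≃o
      {S : Set (Equiv.Perm (Fin (n + 1))) // S = ∅ ∨ ∃ C, S = {τ | RankCompatible H C τ}}) := by
  obtain ⟨y, hy, rfl⟩ := hP
  have hchoice : ∀ (τ : Equiv.Perm (Fin (n + 1))) (I : Finset (Fin (n + 1))),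
      ∃ m, I.Nonempty → m ∈ I ∧ ∀ j ∈ I, τ j ≤ τ m := by
    intro τ I
    rcases I.eq_empty_or_nonempty with rfl | hI
    · exact ⟨0, fun h => absurd h (by simp)⟩
    · obtain ⟨m, hm⟩ := I.exists_max_image τ hI
      exact ⟨m, fun _ => hm⟩
  choose g hg using hchoice
  have hne := (isBuildingSet_stellohedronBuildingSet n).nonempty
  have hmem : ∀ τ, ∀ I ∈ stellohedronBuildingSet n, g τ I ∈ I :=
    fun τ I hI => (hg τ I (hne I hI)).1
  have key : ∀ (l : (Fin (n + 1) → ℝ) →L[ℝ] ℝ) (τ : Equiv.Perm (Fin (n + 1))),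
      (∀ x ∈ nestohedron (stellohedronBuildingSet n) y,
        l x ≤ l (∑ I ∈ stellohedronBuildingSet n, y I • Pi.single (g τ I) 1)) ↔
        RankCompatible H (fun i => l (Pi.single i 1)) τ := by
    intro l τ
    refine (forall_mem_nestohedron_le_iff hy (hmem τ) (l : (Fin (n + 1) → ℝ) →ₗ[ℝ] ℝ)).trans ?_
    rw [rankCompatible_pos_iff hH]
    constructor
    · intro h i j hi hj
      -- This test set isolates one comparison: it belongs to the building set, and `i` is its
      -- highest-ranked element.
      have hlast : Fin.last n ∈ ({Fin.last n, i, j} : Finset (Fin (n + 1))) := by simp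
      have hgi : g τ {Fin.last n, i, j} = i := by
        obtain ⟨h1, h2⟩ := hg τ {Fin.last n, i, j} ⟨_, hlast⟩
        refine τ.injective (le_antisymm ?_ (h2 i (by simp)))
        simp only [Finset.mem_insert, Finset.mem_singleton] at h1
        rcases h1 with h1 | h1 | h1 <;> rw [h1]
        exacts [hi, hj]
      have := h _ (mem_stellohedronBuildingSet.2 (Or.inr hlast)) j (by simp)
      rwa [hgi] at this
    · intro h I hI j hj
      obtain ⟨h1, h2⟩ := hg τ I (hne I hI)
      rcases mem_stellohedronBuildingSet.1 hI with ⟨i, rfl⟩ | hlast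
      · rw [Finset.mem_singleton.1 h1, Finset.mem_singleton.1 hj]
      · exact h _ _ (h2 _ hlast) (h2 _ hj)
  refine nonempty_faces_orderIso (convex_nestohedron _ _)
    (fun τ => ∑ I ∈ stellohedronBuildingSet n, y I • (Pi.single (g τ I) 1 : Fin (n + 1) → ℝ))
    (fun τ => sum_smul_single_mem_nestohedron (hmem τ)) (RankCompatible H)
    (exists_rankCompatible H) (fun l => ⟨_, key l⟩) fun C => ?_
  refine ⟨∑ i, C i • ContinuousLinearMap.proj i, fun τ => (key _ τ).trans ?_⟩
  have : (fun i => (∑ j, C j • ContinuousLinearMap.proj (R := ℝ) (φ := fun _ => ℝ) j :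
      (Fin (n + 1) → ℝ) →L[ℝ] ℝ) (Pi.single i 1)) = C := by
    ext i
    simp [Pi.single_apply]
  rw [this]

end Nestohedron

/-! ### Initial sums and the ranks where they exceed one. -/

section PartialSums

variable {n : ℕ} (b : Fin n → ℕ)

/-- The sum of the first `m` entries of `b`. -/
def initialSum (m : ℕ) : ℕ := ∑ j ∈ Finset.univ.filter (fun j : Fin n => (j : ℕ) < m), b j

theorem sum_Iic_eq_initialSum (i : Fin n) : ∑ j ∈ Finset.Iic i, b j = initialSum b (i + 1) := by
  have : Finset.Iic i = Finset.univ.filter fun j : Fin n => (j : ℕ) < i + 1 := by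
    ext j
    rw [Finset.mem_Iic, Finset.mem_filter, Fin.le_def, Nat.lt_succ_iff]
    simp
  rw [this, initialSum]

theorem initialSum_mono : Monotone (initialSum b) := fun _ _ h =>
  Finset.sum_le_sum_of_subset fun j hj => by
    simp only [Finset.mem_filter, Finset.mem_univ, true_and] at hj ⊢
    omega

theorem initialSum_one (hn : 0 < n) : initialSum b 1 = b ⟨0, hn⟩ := by
  rw [← zero_add 1, ← sum_Iic_eq_initialSum b ⟨0, hn⟩]
  have : Finset.Iic (⟨0, hn⟩ : Fin n) = {⟨0, hn⟩} := by
    ext j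
    simp [Fin.le_def, Fin.ext_iff]
  simp [this]

variable {b}

theorem initialSum_lt_initialSum (hb : ∀ i, 0 < b i) {m k : ℕ} (hmk : m < k) (hk : k ≤ n) :
    initialSum b m < initialSum b k := by
  refine Finset.sum_lt_sum_of_subset (i := ⟨m, by omega⟩) (fun j hj => ?_) (by simpa) (by simp)
    (hb _) fun _ _ _ => Nat.zero_le _
  simp only [Finset.mem_filter, Finset.mem_univ, true_and] at hj ⊢
  omega

theorem one_lt_initialSum_iff (hn : 0 < n) (hb : ∀ i, 0 < b i) (hb₁ : b ⟨0, hn⟩ = 1) {m : ℕ}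
    (hm : m ≤ n) : 1 < m ↔ 1 < initialSum b m := by
  have h₁ : initialSum b 1 = 1 := (initialSum_one b hn).trans hb₁
  exact ⟨fun h => h₁.symm.trans_lt (initialSum_lt_initialSum hb h hm),
    fun h => (initialSum_mono b).reflect_lt (h₁.trans_lt h)⟩

theorem one_lt_initialSum (hn : 0 < n) (hb₁ : 2 ≤ b ⟨0, hn⟩) {m : ℕ} (hm : 0 < m) :
    1 < initialSum b m :=
  (initialSum_one b hn ▸ hb₁ : 1 < initialSum b 1).trans_le (initialSum_mono b hm)

end PartialSums

/-! ### Maximizers on the parking-function polytope. -/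

section Parking

variable {n : ℕ} (b : Fin n → ℕ)

/-- The initial sums of `b`, replaced by one where they vanish. -/
def posInitialSum (m : ℕ) : ℕ := max 1 (initialSum b m)

theorem posInitialSum_mono : Monotone (posInitialSum b) := fun _ _ h =>
  max_le_max le_rfl (initialSum_mono b h)

variable {b}

/-- Parking functions are bounded by the initial sums in some order, which may include the
empty one. -/
theorem isBParkingFunction_iff {β : Fin n → ℕ} (hb : ∀ i, 0 < b i) :
    IsBParkingFunction b β ↔ (∀ i, 0 < β i) ∧
      ∃ τ : Equiv.Perm (Fin (n + 1)), ∀ i : Fin n, β i ≤ posInitialSum b (τ i.castSucc) := by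
  refine and_congr_right fun hβ => ⟨?_, ?_⟩
  · rintro ⟨σ, -, hσ⟩
    -- The last element gets rank zero, and `i.castSucc` gets rank `σ.symm i + 1`.
    refine ⟨(finSuccEquivLast.trans (Equiv.optionCongr σ.symm)).trans (finSuccEquiv n).symm,
      fun i => ?_⟩
    have := hσ (σ.symm i)
    rw [sum_Iic_eq_initialSum] at this
    rw [Equiv.apply_symm_apply] at this
    refine (this.trans (le_max_right 1 _)).trans_eq ?_
    simp only [Equiv.trans_apply, finSuccEquivLast_castSucc, Equiv.optionCongr_apply,
      Option.map_some, finSuccEquiv_symm_some, Fin.val_succ]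
    rfl
  · rintro ⟨τ, hτ⟩
    refine ⟨Tuple.sort β, Tuple.monotone_sort β, fun i => ?_⟩
    rw [sum_Iic_eq_initialSum]
    by_contra! hlt
    have hpos : 0 < initialSum b (i + 1) :=
      (Nat.zero_le _).trans_lt (initialSum_lt_initialSum hb (Nat.succ_pos i) i.isLt)
    -- Pigeonhole: the `n - i` sorted entries from `i` on would all need ranks above `i + 1`, of
    -- which there are only `n - i - 1`.
    have hcard := Finset.card_le_card_of_injOn (s := Finset.Ici i) (t := Finset.Ioi i.succ)
      (fun j => τ (Tuple.sort β j).castSucc) (fun j hj => ?_)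
      (fun j _ k _ h => by simpa using h)
    · simp only [Fin.card_Ici, Fin.card_Ioi, Fin.val_succ] at hcard
      omega
    · have h1 : β (Tuple.sort β i) ≤ β (Tuple.sort β j) :=
        Tuple.monotone_sort β (by simpa using hj)
      have h2 := hτ (Tuple.sort β j)
      simp only [posInitialSum, le_max_iff] at h2
      have h3 : initialSum b (i + 1) < initialSum b (τ (Tuple.sort β j).castSucc) := by omega
      simpa [Fin.lt_def] using (initialSum_mono b).reflect_lt h3

/-- The values of a vertex of the parking-function polytope, indexed by a permutation of
`Fin (n + 1)`: the ranks above that of the last element receive initial sums, the others one. -/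
def vertexValue (b : Fin n → ℕ) (τ : Equiv.Perm (Fin (n + 1))) (k : Fin (n + 1)) : ℕ :=
  if τ (Fin.last n) ≤ τ k then posInitialSum b (τ k) else 1

theorem one_le_vertexValue (τ : Equiv.Perm (Fin (n + 1))) (k : Fin (n + 1)) :
    1 ≤ vertexValue b τ k := by
  unfold vertexValue posInitialSum
  split_ifs <;> simp

theorem vertexValue_le (τ : Equiv.Perm (Fin (n + 1))) (k : Fin (n + 1)) :
    vertexValue b τ k ≤ posInitialSum b (τ k) := by
  unfold vertexValue posInitialSum
  split_ifs <;> simp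

/-- The value at the last element is a spare one, so exchanges involving that position also yield
parking functions. -/
theorem isBParkingFunction_vertexValue_comp (hb : ∀ i, 0 < b i)
    (τ ρ : Equiv.Perm (Fin (n + 1))) :
    IsBParkingFunction b fun i => vertexValue b τ (ρ i.castSucc) :=
  (isBParkingFunction_iff hb).2
    ⟨fun _ => one_le_vertexValue _ _, ρ.trans τ, fun _ => vertexValue_le _ _⟩

theorem sum_swap_sub_sum {ι R : Type*} [Fintype ι] [DecidableEq ι] [CommRing R]
    (C v : ι → R) {i j : ι}
    (hij : i ≠ j) :
    ∑ k, C k * v (Equiv.swap i j k) - ∑ k, C k * v k = (C j - C i) * (v i - v j) := by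
  rw [← Finset.sum_sub_distrib, ← Finset.sum_subset (Finset.subset_univ {i, j}),
    Finset.sum_pair hij]
  · simp
    ring
  · intro k _ hk
    simp only [Finset.mem_insert, Finset.mem_singleton, not_or] at hk
    rw [Equiv.swap_apply_of_ne_of_ne hk.1 hk.2, sub_self]

variable {H : ℕ → Prop} {C : Fin (n + 1) → ℝ} {τ : Equiv.Perm (Fin (n + 1))}

/-- Exchange argument: swapping the values at a violating pair gives a parking function of larger
weight. One of the two may be the last element, whose weight is zero. -/
theorem rankCompatible_of_forall_le (hb : ∀ i, 0 < b i) (hH : ∀ m ≤ n, H m ↔ 1 < initialSum b m)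
    (hC : C (Fin.last n) = 0)
    (h : ∀ β, IsBParkingFunction b β →
      ∑ i : Fin n, C i.castSucc * β i ≤ ∑ i : Fin n, C i.castSucc * vertexValue b τ i.castSucc) :
    RankCompatible H C τ := by
  intro i j hi hlast hji
  by_contra! hlt
  have hne : i ≠ j := fun h => hji.ne (by rw [h])
  have hsum := sum_swap_sub_sum C (fun k => (vertexValue b τ k : ℝ)) hne
  have hle := h _ (isBParkingFunction_vertexValue_comp hb τ (Equiv.swap i j))
  -- Strictness needs `H` here: truncation at one could otherwise make the two values equal.
  have hval : vertexValue b τ j < vertexValue b τ i := by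
    have h1 := (hH _ (by omega)).1 hi
    have h2 := initialSum_lt_initialSum hb hji (by omega)
    refine (vertexValue_le τ j).trans_lt ?_
    rw [vertexValue, if_pos hlast]
    simp only [posInitialSum]
    omega
  have hpos : 0 < (C j - C i) * ((vertexValue b τ i : ℝ) - vertexValue b τ j) :=
    mul_pos (sub_pos.2 hlt) (sub_pos.2 (by exact_mod_cast hval))
  rw [Fin.sum_univ_castSucc, Fin.sum_univ_castSucc, hC] at hsum
  linarith

/-- Splitting the weights into positive and negative parts, rearrangement bounds the former and `1 ≤
β i` the latter; the point of `τ` attains both bounds. -/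
theorem sum_mul_le_of_rankCompatible (hb : ∀ i, 0 < b i)
    (hH : ∀ m ≤ n, H m ↔ 1 < initialSum b m) (hC : C (Fin.last n) = 0)
    (h : RankCompatible H C τ) {β : Fin n → ℕ} (hβ : IsBParkingFunction b β) :
    ∑ i : Fin n, C i.castSucc * β i ≤
      ∑ i : Fin n, C i.castSucc * vertexValue b τ i.castSucc := by
  obtain ⟨hpos, ρ, hρ⟩ := (isBParkingFunction_iff hb).1 hβ
  have hmono : Monovary (fun k => max (C k) 0) (fun k => (posInitialSum b (τ k) : ℝ)) := by
    intro i j hij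
    have hij : posInitialSum b (τ i) < posInitialSum b (τ j) := Nat.cast_lt.1 hij
    have hlt : τ i < τ j := (posInitialSum_mono b).reflect_lt hij
    have hHj : 1 < initialSum b (τ j) := by
      simp only [posInitialSum] at hij
      omega
    rcases le_or_gt (τ (Fin.last n)) (τ j) with hj | hj
    · exact max_le_max (h j i ((hH _ (by omega)).2 hHj) hj hlt) le_rfl
    -- Below the rank of the last element, compatibility forces weight at most zero, so the positive
    -- part vanishes.
    · have := h (Fin.last n) i
        ((hH _ (by omega)).2 (hHj.trans_le (initialSum_mono b hj.le))) le_rfl (hlt.trans hj)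
      rw [hC] at this
      simp [max_eq_right this]
  -- With this permutation the rearranged sum carries the ranks of `ρ` in place of those of `τ`.
  have hrearr := hmono.sum_mul_comp_perm_le_sum_mul (σ := ρ.trans τ.symm)
  simp only [Equiv.trans_apply, Equiv.apply_symm_apply] at hrearr
  rw [Fin.sum_univ_castSucc, Fin.sum_univ_castSucc, hC] at hrearr
  simp only [max_self, zero_mul, add_zero] at hrearr
  have hsplit : ∀ k, C k = max (C k) 0 - max (-C k) 0 := fun k => by
    rcases le_total (C k) 0 with hk | hk
    · rw [max_eq_right hk, max_eq_left (neg_nonneg.2 hk)]; ring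
    · rw [max_eq_left hk, max_eq_right (neg_nonpos.2 hk)]; ring
  have hupper : ∀ i : Fin n, C i.castSucc * β i ≤
      max (C i.castSucc) 0 * posInitialSum b (ρ i.castSucc) - max (-C i.castSucc) 0 := by
    intro i
    have h1 : (1 : ℝ) ≤ β i := by exact_mod_cast hpos i
    have h2 : (β i : ℝ) ≤ posInitialSum b (ρ i.castSucc) := by exact_mod_cast hρ i
    have h3 := mul_le_mul_of_nonneg_left h2 (le_max_right (C i.castSucc) 0)
    have h4 := mul_le_mul_of_nonneg_left h1 (le_max_right (-C i.castSucc) 0)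
    have h5 : C i.castSucc * β i =
        max (C i.castSucc) 0 * β i - max (-C i.castSucc) 0 * β i := by
      rw [← sub_mul, ← hsplit]
    linarith
  have hexact : ∀ i : Fin n, C i.castSucc * vertexValue b τ i.castSucc =
      max (C i.castSucc) 0 * posInitialSum b (τ i.castSucc) - max (-C i.castSucc) 0 := by
    intro i
    rcases lt_trichotomy (C i.castSucc) 0 with hi | hi | hi
    -- A value above one would put `i` above the last element at a rank that matters, forcing a
    -- nonnegative weight.
    · have hv : vertexValue b τ i.castSucc = 1 := by
        unfold vertexValue
        split_ifs with hlast
        · by_contra hne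
          have hHi : 1 < initialSum b (τ i.castSucc) := by
            simp only [posInitialSum] at hne
            omega
          have hlt : τ (Fin.last n) < τ i.castSucc :=
            hlast.lt_of_ne fun he => (Fin.castSucc_lt_last i).ne' (τ.injective he)
          have := h _ _ ((hH _ (by omega)).2 hHi) hlast hlt
          linarith
        · rfl
      rw [hv, max_eq_right hi.le, max_eq_left (neg_nonneg.2 hi.le)]
      simp
    · simp [hi]
    -- If truncation changed the value, `i` would lie below the last element at a rank that matters,
    -- forcing a nonpositive weight.
    · have hv : vertexValue b τ i.castSucc = posInitialSum b (τ i.castSucc) := by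
        unfold vertexValue
        split_ifs with hlast
        · rfl
        · by_contra hne
          have hHi : 1 < initialSum b (τ i.castSucc) := by
            simp only [posInitialSum] at hne
            omega
          have hlt := not_le.1 hlast
          have := h _ _ ((hH _ (by omega)).2 (hHi.trans_le (initialSum_mono b hlt.le))) le_rfl hlt
          linarith
      rw [hv, max_eq_left hi.le, max_eq_right (neg_nonpos.2 hi.le), sub_zero]
  calc _ ≤ ∑ i : Fin n, (max (C i.castSucc) 0 * (posInitialSum b (ρ i.castSucc) : ℝ) -
        max (-C i.castSucc) 0) := Finset.sum_le_sum fun i _ => hupper i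
    _ ≤ ∑ i : Fin n, (max (C i.castSucc) 0 * (posInitialSum b (τ i.castSucc) : ℝ) -
        max (-C i.castSucc) 0) := by
      simp only [Finset.sum_sub_distrib]
      linarith
    _ = _ := (Finset.sum_congr rfl fun i _ => hexact i).symm

theorem bParkingPolytope_faces (hb : ∀ i, 0 < b i) (hH : ∀ m ≤ n, H m ↔ 1 < initialSum b m) :
    Nonempty ({F : Set (Fin n → ℝ) // IsExposed ℝ (bParkingPolytope b) F} ≃o
      {S : Set (Equiv.Perm (Fin (n + 1))) // S = ∅ ∨ ∃ C, S = {τ | RankCompatible H C τ}}) := by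
  have hmem : ∀ β : Fin n → ℕ, IsBParkingFunction b β →
      (fun i => (β i : ℝ)) ∈ bParkingPolytope b := fun β hβ => subset_convexHull ℝ _ ⟨β, hβ, rfl⟩
  have key : ∀ (l : (Fin n → ℝ) →L[ℝ] ℝ) (C : Fin (n + 1) → ℝ), C (Fin.last n) = 0 →
      (∀ x, l x = ∑ i, C i.castSucc * x i) → ∀ τ : Equiv.Perm (Fin (n + 1)),
      (∀ x ∈ bParkingPolytope b, l x ≤ l fun i => (vertexValue b τ i.castSucc : ℝ)) ↔
        RankCompatible H C τ := by
    intro l C hC hl τ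
    constructor
    · refine fun h => rankCompatible_of_forall_le hb hH hC fun β hβ => ?_
      simpa only [hl] using h _ (hmem β hβ)
    · intro h
      refine convexHull_min (𝕜 := ℝ) ?_ (convex_halfSpace_le l.isLinear
        (l fun i => (vertexValue b τ i.castSucc : ℝ)))
      rintro _ ⟨β, hβ, rfl⟩
      change l _ ≤ l _
      simpa only [hl] using sum_mul_le_of_rankCompatible hb hH hC h hβ
  refine nonempty_faces_orderIso (convex_convexHull ℝ _)
    (fun τ i => (vertexValue b τ i.castSucc : ℝ))
    (fun τ => hmem _ (isBParkingFunction_vertexValue_comp hb τ 1)) (RankCompatible H)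
    (exists_rankCompatible H) (fun l => ?_) fun C => ?_
  -- Functionals correspond to weights with last entry zero; conversely, subtracting the last entry
  -- normalizes arbitrary weights without changing compatibility.
  · refine ⟨Fin.snoc (fun i => l (Pi.single i 1)) 0, key l _ (by simp) fun x => ?_⟩
    conv_lhs => rw [pi_eq_sum_univ' x]
    simp [mul_comm]
  · refine ⟨∑ i : Fin n, (C i.castSucc - C (Fin.last n)) • ContinuousLinearMap.proj i,
      fun τ => (key _ (fun k => C k - C (Fin.last n)) (sub_self _) (fun x => ?_) τ).trans
        (rankCompatible_sub_const _)⟩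
    simp

theorem parkingPolytope_eq (n : ℕ) : parkingPolytope n = bParkingPolytope fun _ : Fin n => 1 := by
  simp [parkingPolytope, bParkingPolytope, IsParkingFunction, IsBParkingFunction]

end Parking

theorem mainTheorem8 (n : ℕ) (hn : 0 < n) (b : Fin n → ℕ) (hb : ∀ i, 0 < b i) :
    (b ⟨0, hn⟩ = 1 → CombinatoriallyEquivalent (bParkingPolytope b) (parkingPolytope n)) ∧
      (2 ≤ b ⟨0, hn⟩ → ∀ P : Set (Fin (n + 1) → ℝ), IsStellohedron n P →
        CombinatoriallyEquivalent (bParkingPolytope b) P) := by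
  refine ⟨fun hb₁ => ?_, fun hb₁ P hP => ?_⟩
  · obtain ⟨e⟩ := bParkingPolytope_faces (H := (1 < ·)) hb
      fun m hm => one_lt_initialSum_iff hn hb hb₁ hm
    obtain ⟨f⟩ := bParkingPolytope_faces (n := n) (b := fun _ => 1) (H := (1 < ·))
      (fun _ => one_pos) fun m hm => one_lt_initialSum_iff hn (fun _ => one_pos) rfl hm
    rw [parkingPolytope_eq]
    exact ⟨e.trans f.symm⟩
  -- The same `H` serves both sides: it is the defining condition for the parking polytope and holds
  -- at all positive ranks, as the stellohedron requires.
  · obtain ⟨e⟩ := bParkingPolytope_faces (H := (1 < initialSum b ·)) hb fun m _ => Iff.rfl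
    obtain ⟨f⟩ := stellohedron_faces (H := (1 < initialSum b ·))
      (fun m hm _ => one_lt_initialSum hn hb₁ hm) hP
    exact ⟨e.trans f.symm⟩
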